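/- An algebra $\mathbf A$ is a set $A$ together with a family of finitary operations. Let $n\ge 2$. Index the vertices of the cube $\{0,1\}^n$ by $j\in\{0,\dots,2^n-1\}$, where the $i$-th coordinate $j_i$ ($1\le i\le n$) of the vertex $j$ is the binary digit of $j$ at $2^{i-1}$; the vertex $2^n-1$ is $(1,\dots,1)$. A $(2^n-1)$-ary term $q_n$ is a *strong $n$-cube term* of $\mathbf A$ if $q_n^{\mathbf A}(x_0,\dots,x_{2^n-2})=x_{2^n-1}$ for every $(x_0,\dots,x_{2^n-1})\in A^{2^n}$ for which there is an $i\in\{1,\dots,n\}$ such that $x_j=x_{j+2^{i-1}}$ for all $j$ with $j_i=0$. The $k$-ary higher commutator $[\alpha_1,\dots,\alpha_k]$ of congruences of $\mathbf A$ is the smallest congruence $\delta$ of $\mathbf A$ such that for all tuples $\mathbf a_i,\mathbf b_i$ of elements of $A$ (of equal finite length for each $i$) with $\mathbf a_i\equiv_{\alpha_i}\mathbf b_i$ componentwise ($1\le i\le k$) and all terms $t$ of the appropriate arity: if $t^{\mathbf A}(\mathbf x_1,\dots,\mathbf x_{k-1},\mathbf a_k)\equiv_\delta t^{\mathbf A}(\mathbf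 x_1,\dots,\mathbf x_{k-1},\mathbf b_k)$ for each of the $2^{k-1}-1$ choices of one of $\mathbf a_i,\mathbf b_i$ as $\mathbf x_i$ ($1\le i\le k-1$) other than the choice of $\mathbf b_i$ for every $i$, then also $t^{\mathbf A}(\mathbf b_1,\dots,\mathbf b_{k-1},\mathbf a_k)\equiv_\delta t^{\mathbf A}(\mathbf b_1,\dots,\mathbf b_{k-1},\mathbf b_k)$. The algebra $\mathbf A$ is *supernilpotent of degree $d$* if $[1_{\mathbf A},\dots,1_{\mathbf A}]=0_{\mathbf A}$ for the commutator of arity $d+1$, where $1_{\mathbf A}$ and $0_{\mathbf A}$ are the full and the equality congruence. A *polynomial term* of $\mathbf A$ is a term of the expansion of $\mathbf A$ by a constant symbol for each element of $A$. **Theorem.** Let $n\ge 2$ and let $\mathbf A$ be an algebra with a strong $n$-cube term $q_n$. Then the following are equivalent: 1. $\mathbf A$ is supernilpotent of degree $n-1$; 2. for all positive integers $m_1,\dots,m_n$, all terms $t$ of arity $m_1+\dots+m_n$ and all $\mathbf a_i,\mathbf b_i\in A^{m_i}$ ($1\le i\le n$), $$q_n^{\mathbf A}\bigl(t^{\mathbf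 A}(\mathbf a_1,\dots,\mathbf a_n),\,t^{\mathbf A}(\mathbf b_1,\mathbf a_2,\dots,\mathbf a_n),\dots,t^{\mathbf A}(\mathbf a_1,\mathbf b_2,\dots,\mathbf b_n)\bigr)=t^{\mathbf A}(\mathbf b_1,\dots,\mathbf b_n),$$ where the $j$-th argument of $q_n$ ($0\le j\le 2^n-2$) is $t^{\mathbf A}(\mathbf c_1,\dots,\mathbf c_n)$ with $\mathbf c_i=\mathbf b_i$ if $j_i=1$ and $\mathbf c_i=\mathbf a_i$ if $j_i=0$; 3. for all $n$-ary polynomial terms $t$ of $\mathbf A$ and all $a_1,b_1,\dots,a_n,b_n\in A$, with the arguments of $q_n$ in the same order, $$q_n^{\mathbf A}\bigl(t^{\mathbf A}(a_1,\dots,a_n),\,t^{\mathbf A}(b_1,a_2,\dots,a_n),\dots,t^{\mathbf A}(a_1,b_2,\dots,b_n)\bigr)=t^{\mathbf A}(b_1,\dots,b_n).$$ -/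

import Mathlib

universe u v w

namespace UniversalAlgebra

/-- A congruence of an algebra `A` in the language `L`: an equivalence relation compatible with all
basic operations. -/
structure Congruence (L : FirstOrder.Language.{u, v}) (A : Type w) [L.Structure A] extends Setoid A where
  compatible : ∀ {k : ℕ} (f : L.Functions k) (x y : Fin k → A),
    (∀ i, r (x i) (y i)) → r (FirstOrder.Language.Structure.funMap f x)
      (FirstOrder.Language.Structure.funMap f y)

namespace Congruence

variable {L : FirstOrder.Language.{u, v}} {A : Type w} [L.Structure A]

/-- Congruences are ordered by inclusion. -/
instance : LE (Congruence L A) :=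
  ⟨fun θ ψ => ∀ x y, θ.r x y → ψ.r x y⟩

/-- The full congruence `1_A`. -/
instance : Top (Congruence L A) :=
  ⟨{ r := fun _ _ => True
     iseqv := ⟨fun _ => trivial, fun _ => trivial, fun _ _ => trivial⟩
     compatible := fun _ _ _ _ => trivial }⟩

/-- The equality congruence `0_A`. -/
instance : Bot (Congruence L A) :=
  ⟨{ r := fun x y => x = y
     iseqv := ⟨fun _ => rfl, fun h => h.symm, fun h₁ h₂ => h₁.trans h₂⟩
     compatible := fun _ _ _ h => congrArg _ (funext h) }⟩

/-- The intersection of a set of congruences. -/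
instance : InfSet (Congruence L A) :=
  ⟨fun S =>
   { r := fun x y => ∀ θ ∈ S, θ.r x y
     iseqv := ⟨fun x θ _ => θ.iseqv.refl x, fun h θ hθ => θ.iseqv.symm (h θ hθ),
       fun h₁ h₂ θ hθ => θ.iseqv.trans (h₁ θ hθ) (h₂ θ hθ)⟩
     compatible := fun f x y h θ hθ => θ.compatible f x y fun i => h i θ hθ }⟩

end Congruence

/-- For blocks `a i`, `b i` of elements of `A` (`i : Fin n`, the `i`-th block of length `m i`), the
concatenated tuple whose `i`-th block is `b i` if `v i` is true, and `a i` if `v i` is false. -/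
def blockPoint {A : Type w} {n : ℕ} {m : Fin n → ℕ} (a b : (i : Fin n) → Fin (m i) → A)
    (v : Fin n → Bool) : ((i : Fin n) × Fin (m i)) → A :=
  fun p => if v p.1 then b p.1 p.2 else a p.1 p.2

/-- The term condition: `α 0, …, α (k - 1)` centralize `α k` modulo `δ`. A term with variables
indexed by the pairs `(i, j)` with `j < m i` is a term of arity `m 0 + ⋯ + m k`, with the variables
arranged in `k + 1` blocks. (Polynomial terms give the same condition: the parameters may be
placed into a block as entries on which `a` and `b` agree.) -/
def Centralizes {L : FirstOrder.Language.{u, v}} {A : Type w} [L.Structure A] {k : ℕ}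
    (α : Fin (k + 1) → Congruence L A) (δ : Congruence L A) : Prop :=
  ∀ (m : Fin (k + 1) → ℕ) (t : L.Term ((i : Fin (k + 1)) × Fin (m i)))
    (a b : (i : Fin (k + 1)) → Fin (m i) → A),
    (∀ i j, (α i).r (a i j) (b i j)) →
    (∀ v : Fin k → Bool, v ≠ (fun _ => true) →
      δ.r (t.realize (blockPoint a b (Fin.snoc (α := fun _ => Bool) v false)))
        (t.realize (blockPoint a b (Fin.snoc (α := fun _ => Bool) v true)))) →
    δ.r (t.realize (blockPoint a b (Fin.snoc (α := fun _ => Bool) (fun _ => true) false)))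
      (t.realize (blockPoint a b (Fin.snoc (α := fun _ => Bool) (fun _ => true) true)))

/-- The higher commutator `[α 0, …, α k]` of arity `k + 1`: the smallest congruence `δ` such that
`α 0, …, α (k - 1)` centralize `α k` modulo `δ`. -/
def higherCommutator {L : FirstOrder.Language.{u, v}} {A : Type w} [L.Structure A] {k : ℕ}
    (α : Fin (k + 1) → Congruence L A) : Congruence L A :=
  sInf {δ | Centralizes α δ}

/-- The smallest congruence in the definition of the higher commutator exists. -/
theorem isLeast_higherCommutator {L : FirstOrder.Language.{u, v}} {A : Type w} [L.Structure A] {k : ℕ}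
    (α : Fin (k + 1) → Congruence L A) :
    IsLeast {δ | Centralizes α δ} (higherCommutator α) :=
  ⟨fun m t a b hab h δ hδ => hδ m t a b hab fun v hv => h v hv δ hδ,
    fun δ hδ _ _ hxy => hxy δ hδ⟩

/-- The algebra `A` is supernilpotent of degree `d`: `[1_A, …, 1_A] = 0_A`, where the commutator
has arity `d + 1`. -/
def IsSupernilpotent (L : FirstOrder.Language.{u, v}) (A : Type w) [L.Structure A] (d : ℕ) : Prop :=
  higherCommutator (fun _ : Fin (d + 1) => (⊤ : Congruence L A)) = ⊥

/-- The `j`-th vertex of the `n`-dimensional cube, given by the binary digits of `j`. For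
`j = 0, …, 2 ^ n - 2` these are, in the order `(0,…,0)`, `(1,0,…,0)`, …, `(0,1,…,1)`, all vertices
except `(1,…,1)`. -/
def cubeVertex (n : ℕ) (j : Fin (2 ^ n - 1)) : Fin n → Bool :=
  fun i => (j : ℕ).testBit i

/-- `q` is a strong `n`-cube term of the algebra `A`: whenever a labelling `x` of the vertices of
the `n`-dimensional cube by elements of `A` does not depend on one of the coordinates,
`q` computes the label of `(1,…,1)` from the labels of the other vertices. -/
def IsStrongCubeTerm {L : FirstOrder.Language.{u, v}} (A : Type w) [L.Structure A] (n : ℕ)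
    (q : L.Term (Fin (2 ^ n - 1))) : Prop :=
  ∀ (x : (Fin n → Bool) → A) (i : Fin n),
    (∀ v, x (Function.update v i false) = x (Function.update v i true)) →
    q.realize (fun j => x (cubeVertex n j)) = x (fun _ => true)

end UniversalAlgebra

/-!
The second entry of the list (the *block condition*) says that every cube of term values is
completed at the vertex `(1,…,1)` by `q`, and the third (the *polynomial condition*) says the same
for polynomials whose blocks of variables have length one. The block condition gives the polynomial
condition because the finitely many constants of a polynomial term can be put into a block, as
entries on which `a` and `b` agree (`exists_term_blockPoint`). The block condition gives the term
condition: a cube whose edges in the last direction, except one, join equal elements agrees outside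
`(1,…,1)` with a cube that does not depend on the last coordinate, and `q` completes both
(`centralizes_bot_of_forall_completes`).

The converse implications both pass through *absorption* (`AbsorbingTrivial`): a polynomial `f`
that takes the value `c` whenever one of its blocks of arguments is the block of `a` takes the
value `c` everywhere.

* Supernilpotence gives absorption, by the term condition applied to the cube of values of `f`.
* The polynomial condition gives absorption (`absorbingTrivial_of_completes`). Among the points `b` with
  `f b ≠ c`, take one that differs from `a` in as few variables as possible. It differs from `a` in
  some variable of each block; moving just these variables gives a cube with value `c` outside
  `(1,…,1)`, by minimality, so the polynomial condition and idempotence of `q` give `f b = c`.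
* Absorption gives the block condition (`completes_of_absorbingTrivial`). For a term `t`, let `g x` be the
  value of `q` at the cube of all `t (y)`, where each block of `y` is that of `a` or that of `x`.
  If some block of `x` is that of `a`, this cube does not depend on one coordinate, so `g x = t x`.
  With a Mal'cev operation `p`, derived from `q`, the polynomial `f x = p (t x) (g x) c` is
  absorbing with value `c`. For `c = g b` this gives `t b = p (t b) (g b) (g b) = g b`, which
  is the block condition.
-/

namespace UniversalAlgebra

open FirstOrder FirstOrder.Language

variable {L : FirstOrder.Language.{u, v}} {A : Type w} [L.Structure A]

/-! ### Polynomial functions -/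

/-- `f` is a polynomial function of the algebra `A`: it is induced by a term with constants. -/
def IsPolynomial (L : FirstOrder.Language.{u, v}) {A : Type w} [L.Structure A] {ι : Type*}
    (f : (ι → A) → A) : Prop :=
  ∃ t : (L.withConstants A).Term ι, ∀ x, t.realize x = f x

theorem IsPolynomial.var {ι : Type*} (p : ι) : IsPolynomial L (fun x : ι → A => x p) :=
  ⟨Term.var p, fun _ => rfl⟩

theorem IsPolynomial.const {ι : Type*} (c : A) : IsPolynomial L (fun _ : ι → A => c) :=
  ⟨(L.con c).term, fun _ => Term.realize_constants⟩

theorem IsPolynomial.realize {ι κ : Type*} (s : L.Term κ) {f : κ → (ι → A) → A}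
    (hf : ∀ k, IsPolynomial L (f k)) : IsPolynomial L (fun x => s.realize fun k => f k x) := by
  choose t ht using hf
  exact ⟨((L.lhomWithConstants A).onTerm s).subst t, fun x => by simp [ht]⟩

theorem IsPolynomial.comp {ι κ : Type*} {g : (κ → A) → A} (hg : IsPolynomial L g)
    {f : κ → (ι → A) → A} (hf : ∀ k, IsPolynomial L (f k)) :
    IsPolynomial L (fun x => g fun k => f k x) := by
  obtain ⟨s, hs⟩ := hg
  choose t ht using hf
  exact ⟨s.subst t, fun x => by simp [ht, hs]⟩

theorem IsPolynomial.ite {ι : Type*} (P : Prop) [Decidable P] {f g : (ι → A) → A}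
    (hf : IsPolynomial L f) (hg : IsPolynomial L g) :
    IsPolynomial L (fun x => if P then f x else g x) := by
  split_ifs <;> assumption

/-- The cube of values of a polynomial function is also the cube of values of a term with nonempty
blocks: each block is extended by the constants that occur in the polynomial. -/
theorem exists_term_blockPoint {n : ℕ} (i₀ : Fin n) {m : Fin n → ℕ}
    {f : ((i : Fin n) × Fin (m i) → A) → A} (hf : IsPolynomial L f)
    (a b : (i : Fin n) → Fin (m i) → A) :
    ∃ (m' : Fin n → ℕ) (_ : ∀ i, 0 < m' i) (t : L.Term ((i : Fin n) × Fin (m' i)))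
      (a' b' : (i : Fin n) → Fin (m' i) → A),
      ∀ v, t.realize (blockPoint a' b' v) = f (blockPoint a b v) := by
  classical
  obtain ⟨t₀, ht₀⟩ := hf
  set s := t₀.constantsToVars
  let e : s.varFinset → Fin (s.varFinset.card + 1) := fun y => (s.varFinset.equivFin y).castSucc
  have he : Function.Injective e :=
    (Fin.castSucc_injective _).comp s.varFinset.equivFin.injective
  -- The entries that do not hold a constant are irrelevant, but must lie in `A`.
  let val : Fin (s.varFinset.card + 1) → A :=
    Function.extend e (fun y => Sum.elim id (blockPoint a b fun _ => false) y.1)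
      (fun _ => f (blockPoint a b fun _ => false))
  let pos : s.varFinset → (i : Fin n) × Fin (m i + (s.varFinset.card + 1)) := fun y =>
    Sum.elim (fun _ => ⟨i₀, Fin.natAdd (m i₀) (e y)⟩) (fun p => ⟨p.1, Fin.castAdd _ p.2⟩) y.1
  refine ⟨fun i => m i + (s.varFinset.card + 1), fun i => Nat.succ_pos _, s.restrictVar pos,
    fun i => Fin.append (a i) val, fun i => Fin.append (b i) val, fun v => ?_⟩
  rw [← ht₀, ← Term.realize_constantsToVars]
  refine Term.realize_restrictVar _ ?_
  rintro ⟨c | p, hy⟩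
  · have hc : ((L.con c : (L.withConstants A).Constants) : A) = c := rfl
    simp [pos, blockPoint, val, he.extend_apply, hc]
  · simp [pos, blockPoint]

/-! ### Strong cube terms -/

theorem cubeVertex_ne_top {n : ℕ} (j : Fin (2 ^ n - 1)) : cubeVertex n j ≠ fun _ => true := by
  intro h
  refine j.2.ne (Nat.eq_of_testBit_eq fun i => ?_)
  rw [Nat.testBit_two_pow_sub_one]
  by_cases hi : i < n
  · simpa [hi, cubeVertex] using congrFun h ⟨i, hi⟩
  · simpa [hi] using Nat.testBit_lt_two_pow
      ((j.2.trans_le (Nat.sub_le _ _)).trans_le (Nat.pow_le_pow_right two_pos (not_lt.1 hi)))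

/-- The term operation `p (x, y, z)` obtained from a strong cube term by evaluating it at the
cube with label `x` on the face `v i₀ = 1`, label `z` at the vertex whose only zero coordinate is
`i₀`, and label `y` elsewhere; it is a Mal'cev operation. -/
def malcev (A : Type w) [L.Structure A] {n : ℕ} (q : L.Term (Fin (2 ^ n - 1))) (i₀ : Fin n)
    (x y z : A) : A :=
  q.realize fun j => if cubeVertex n j i₀ = true then x else
    if ∀ i ≠ i₀, cubeVertex n j i = true then z else y

theorem malcev_right {n : ℕ} {q : L.Term (Fin (2 ^ n - 1))} (hq : IsStrongCubeTerm A n q)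
    {i₀ i₁ : Fin n} (h : i₁ ≠ i₀) (x y : A) : malcev A q i₀ x y y = x := by
  have := hq (fun v => if v i₀ = true then x else y) i₁ (by simp [h.symm])
  simpa [malcev] using this

theorem malcev_left {n : ℕ} {q : L.Term (Fin (2 ^ n - 1))} (hq : IsStrongCubeTerm A n q)
    (i₀ : Fin n) (y z : A) : malcev A q i₀ y y z = z := by
  have := hq (fun v => if ∀ i ≠ i₀, v i = true then z else y) i₀ (fun v => by
    congr 1
    refine propext (forall₂_congr fun i hi => ?_)
    simp [hi])
  simp only [implies_true, if_true] at this
  refine Eq.trans ?_ this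
  refine congrArg q.realize (funext fun j => ?_)
  by_cases h₀ : cubeVertex n j i₀ = true
  · rw [if_pos h₀, if_neg]
    intro h
    refine cubeVertex_ne_top j (funext fun i => ?_)
    rcases eq_or_ne i i₀ with rfl | hi
    exacts [h₀, h i hi]
  · rw [if_neg h₀]

/-! ### Absorbing polynomials -/

/-- Absorbing polynomials of `A` in `n` blocks of variables are constant: if `f` takes the value `c`
whenever one of the blocks of its argument agrees with that of `a`, then `f` always takes the value
`c`. -/
def AbsorbingTrivial (L : FirstOrder.Language.{u, v}) (A : Type w) [L.Structure A] (n : ℕ) : Prop :=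
  ∀ (m : Fin n → ℕ) (f : ((i : Fin n) × Fin (m i) → A) → A), IsPolynomial L f →
    ∀ (a b : (i : Fin n) × Fin (m i) → A) (c : A),
      (∀ x i, (∀ j, x ⟨i, j⟩ = a ⟨i, j⟩) → f x = c) → f b = c

theorem absorbingTrivial_of_centralizes {d : ℕ}
    (h : Centralizes (fun _ : Fin (d + 1) => (⊤ : Congruence L A)) ⊥) :
    AbsorbingTrivial L A (d + 1) := by
  intro m f hf a b c hc
  obtain ⟨m', -, t, a', b', ht⟩ :=
    exists_term_blockPoint 0 hf (fun i j => a ⟨i, j⟩) (fun i j => b ⟨i, j⟩)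
  have key : ∀ v : Fin (d + 1) → Bool, v ≠ (fun _ => true) →
      t.realize (blockPoint a' b' v) = c := by
    intro v hv
    obtain ⟨i, hi⟩ := Function.ne_iff.1 hv
    rw [ht]
    exact hc _ i fun j => by simp [blockPoint, Bool.eq_false_of_not_eq_true hi]
  have hlow : ∀ v : Fin d → Bool,
      t.realize (blockPoint a' b' (Fin.snoc (α := fun _ => Bool) v false)) = c := fun v =>
    key _ fun h => by simpa using congrFun h (Fin.last d)
  have := h m' t a' b' (fun _ _ => trivial) fun v hv => by
    refine (hlow v).trans (key _ fun h => hv (funext fun i => ?_)).symm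
    simpa using congrFun h i.castSucc
  have htop : (Fin.snoc (α := fun _ => Bool) (fun _ : Fin d => true) true) = fun _ => true := by
    funext i
    induction i using Fin.lastCases <;> simp
  rw [hlow, htop, ht] at this
  exact this.symm

theorem absorbingTrivial_of_completes {n : ℕ} (i₀ : Fin n) {q : L.Term (Fin (2 ^ n - 1))}
    (hq : IsStrongCubeTerm A n q)
    (h : ∀ (t : (L.withConstants A).Term (Fin n)) (a b : Fin n → A),
      q.realize (fun j => t.realize (fun i => if cubeVertex n j i then b i else a i)) =
        t.realize b) :
    AbsorbingTrivial L A n := by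
  classical
  intro m f hf a b c hc
  induction hk : (Finset.univ.filter fun p => b p ≠ a p).card using Nat.strong_induction_on
    generalizing b with
  | _ k ih =>
  by_cases hb : ∃ i, ∀ j, b ⟨i, j⟩ = a ⟨i, j⟩
  · obtain ⟨i, hi⟩ := hb
    exact hc b i hi
  push Not at hb
  choose p hp using hb
  -- The `i`-th variable of `g` replaces the single entry `p i` of the `i`-th block of `b`.
  let g : (Fin n → A) → A := fun y => f fun r => if r.2 = p r.1 then y r.1 else b r
  have hg : IsPolynomial L g := hf.comp fun r => .ite _ (.var _) (.const _)
  obtain ⟨t, ht⟩ := hg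
  have hgb : g (fun i => b ⟨i, p i⟩) = f b := by
    refine congrArg f (funext fun r => ?_)
    rcases r with ⟨i, j⟩
    by_cases hj : j = p i <;> simp [hj]
  have key := h t (fun i => a ⟨i, p i⟩) (fun i => b ⟨i, p i⟩)
  rw [ht, hgb] at key
  rw [← key]
  have hval : ∀ j, t.realize
      (fun i => if cubeVertex n j i then b ⟨i, p i⟩ else a ⟨i, p i⟩) = c := by
    intro j
    obtain ⟨i, hi⟩ := Function.ne_iff.1 (cubeVertex_ne_top j)
    rw [ht]
    refine ih _ ?_ _ rfl
    rw [← hk]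
    refine Finset.card_lt_card (Finset.ssubset_iff_of_subset ?_ |>.2 ⟨⟨i, p i⟩, ?_, ?_⟩)
    · rintro ⟨i', j'⟩ hr
      simp only [Finset.mem_filter, Finset.mem_univ, true_and] at hr ⊢
      contrapose! hr
      by_cases hj : j' = p i'
      · subst hj
        simp [hr]
      · simp [hj, hr]
    · simpa using hp i
    · simp [Bool.eq_false_of_not_eq_true hi]
  simp only [hval]
  exact hq (fun _ => c) i₀ fun _ => rfl

theorem completes_of_absorbingTrivial {n : ℕ} {i₀ i₁ : Fin n} (hi : i₁ ≠ i₀)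
    {q : L.Term (Fin (2 ^ n - 1))} (hq : IsStrongCubeTerm A n q) (h : AbsorbingTrivial L A n)
    {m : Fin n → ℕ} (t : L.Term ((i : Fin n) × Fin (m i))) (a b : (i : Fin n) → Fin (m i) → A) :
    q.realize (fun j => t.realize (blockPoint a b (cubeVertex n j))) =
      t.realize (fun p => b p.1 p.2) := by
  let g : ((i : Fin n) × Fin (m i) → A) → A := fun x =>
    q.realize fun j => t.realize fun p => if cubeVertex n j p.1 then x p else a p.1 p.2
  have hg : IsPolynomial L g := .realize q fun j => .realize t fun p => .ite _ (.var p) (.const _)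
  have ht : IsPolynomial L fun x : (i : Fin n) × Fin (m i) → A => t.realize x :=
    .realize t .var
  set c := g fun p => b p.1 p.2
  have key := h m (fun x => malcev A q i₀ (t.realize x) (g x) c)
    (.realize q fun j => .ite _ ht (.ite _ (.const c) hg)) (fun p => a p.1 p.2)
    (fun p => b p.1 p.2) c fun x i hx => by
      have hgx : g x = t.realize x := by
        have := hq (fun v => t.realize fun p => if v p.1 then x p else a p.1 p.2) i fun v => by
          refine congrArg t.realize (funext fun p => ?_)
          rcases p with ⟨i', j⟩
          rcases eq_or_ne i' i with rfl | hne
          · simp [hx j]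
          · simp [hne]
        simpa using this
      rw [hgx, malcev_left hq]
  rw [malcev_right hq hi] at key
  exact key.symm

/-! ### Completion of cubes and the term condition -/

/-- Completion of cubes of values of terms with nonempty blocks extends to polynomials with
arbitrary blocks. -/
theorem IsPolynomial.completes {n : ℕ} (i₀ : Fin n) {q : L.Term (Fin (2 ^ n - 1))}
    (h : ∀ (m : Fin n → ℕ), (∀ i, 0 < m i) →
      ∀ (t : L.Term ((i : Fin n) × Fin (m i))) (a b : (i : Fin n) → Fin (m i) → A),
        q.realize (fun j => t.realize (blockPoint a b (cubeVertex n j))) =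
          t.realize (fun p => b p.1 p.2))
    {m : Fin n → ℕ} {f : ((i : Fin n) × Fin (m i) → A) → A} (hf : IsPolynomial L f)
    (a b : (i : Fin n) → Fin (m i) → A) :
    q.realize (fun j => f (blockPoint a b (cubeVertex n j))) =
      f (blockPoint a b fun _ => true) := by
  obtain ⟨m', hm', t, a', b', ht⟩ := exists_term_blockPoint i₀ hf a b
  simp only [← ht]
  exact h m' hm' t a' b'

theorem centralizes_bot_of_forall_completes {d : ℕ} {q : L.Term (Fin (2 ^ (d + 1) - 1))}
    (hq : IsStrongCubeTerm A (d + 1) q)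
    (h : ∀ (m : Fin (d + 1) → ℕ) (t : L.Term ((i : Fin (d + 1)) × Fin (m i)))
      (a b : (i : Fin (d + 1)) → Fin (m i) → A),
        q.realize (fun j => t.realize (blockPoint a b (cubeVertex (d + 1) j))) =
          t.realize (blockPoint a b fun _ => true)) :
    Centralizes (fun _ : Fin (d + 1) => (⊤ : Congruence L A)) ⊥ := by
  intro m t a b _ hab
  change t.realize _ = t.realize _
  have htop : (Fin.snoc (α := fun _ => Bool) (fun _ : Fin d => true) true) = fun _ => true := by
    funext i
    induction i using Fin.lastCases <;> simp
  have hdeg := hq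
    (fun v => t.realize (blockPoint a b (Function.update v (Fin.last d) false))) (Fin.last d)
    (fun v => by simp)
  rw [← htop, Fin.update_snoc_last] at hdeg
  rw [htop, ← hdeg, ← h]
  refine congrArg q.realize (funext fun j => ?_)
  have hv := cubeVertex_ne_top j
  generalize cubeVertex (d + 1) j = v at hv ⊢
  induction v using Fin.snocCases with
  | snoc v e =>
  rw [Fin.update_snoc_last]
  cases e with
  | false => rfl
  | true =>
    refine hab v ?_
    rintro rfl
    exact hv htop

theorem isSupernilpotent_iff_centralizes {d : ℕ} :
    IsSupernilpotent L A d ↔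
      Centralizes (fun _ : Fin (d + 1) => (⊤ : Congruence L A)) ⊥ := by
  have hl := isLeast_higherCommutator (fun _ : Fin (d + 1) => (⊤ : Congruence L A))
  constructor
  · intro h
    have h' : higherCommutator (fun _ : Fin (d + 1) => (⊤ : Congruence L A)) = ⊥ := h
    exact h' ▸ hl.1
  · intro h
    have hle := hl.2 h
    have hr : ∀ θ : Congruence L A, θ ≤ ⊥ → θ = ⊥ := by
      rintro ⟨θ, hθ⟩ hle
      have : θ = (⊥ : Congruence L A).toSetoid :=
        Setoid.ext fun x y => ⟨fun hxy => hle x y hxy, fun hxy => by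
          have hxy : x = y := hxy
          exact hxy ▸ θ.refl x⟩
      subst this
      rfl
    exact hr _ hle

end UniversalAlgebra

theorem mainTheorem5 {L : FirstOrder.Language.{u, v}} [L.IsAlgebraic] {A : Type w}
    [L.Structure A]
    (n : ℕ) (hn : 2 ≤ n) (q : L.Term (Fin (2 ^ n - 1)))
    (hq : UniversalAlgebra.IsStrongCubeTerm A n q) :
    List.TFAE [
      UniversalAlgebra.IsSupernilpotent L A (n - 1),
      ∀ (m : Fin n → ℕ), (∀ i, 0 < m i) →
        ∀ (t : L.Term ((i : Fin n) × Fin (m i))) (a b : (i : Fin n) → Fin (m i) → A),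
          q.realize (fun j => t.realize
            (UniversalAlgebra.blockPoint a b (UniversalAlgebra.cubeVertex n j))) =
          t.realize (fun p => b p.1 p.2),
      ∀ (t : (L.withConstants A).Term (Fin n)) (a b : Fin n → A),
        q.realize (fun j => t.realize
          (fun i => if UniversalAlgebra.cubeVertex n j i then b i else a i)) =
        t.realize b] := by
  open UniversalAlgebra in
  obtain ⟨d, rfl⟩ : ∃ d, n = d + 1 := ⟨n - 1, by omega⟩
  have hne : Fin.last d ≠ 0 := by
    rw [Ne, Fin.last_eq_zero_iff]
    omega
  rw [Nat.add_sub_cancel, isSupernilpotent_iff_centralizes]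
  tfae_have 1 → 2 := fun h m _ t a b =>
    completes_of_absorbingTrivial hne hq (absorbingTrivial_of_centralizes h) t a b
  tfae_have 3 → 2 := fun h m _ t a b =>
    completes_of_absorbingTrivial hne hq (absorbingTrivial_of_completes 0 hq h) t a b
  tfae_have 2 → 1 := fun h => centralizes_bot_of_forall_completes hq fun m t a b =>
    IsPolynomial.completes 0 h (.realize t .var) a b
  tfae_have 2 → 3 := fun h t a b => by
    have hf : IsPolynomial L fun x : (_ : Fin (d + 1)) × Fin 1 → A =>
        t.realize fun i => x ⟨i, 0⟩ :=
      IsPolynomial.comp (g := fun x => t.realize x) ⟨t, fun _ => rfl⟩ fun i => .var _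
    simpa [blockPoint] using hf.completes 0 h (fun i _ => a i) (fun i _ => b i)
  tfae_finish
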